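/- Consider the linear neutral differential equation $$(x(t)-a(t)x(g(t)))'=-b(t)x(h(t)) \qquad (*)$$ and suppose that the following hold, where $t_1\ge 0$ is fixed. (a1) $a,b,g,h:[0,\infty)\to\mathbb R$ are Lebesgue measurable, $a$ is bounded and $b$ is essentially bounded on $[0,\infty)$. (a2) $\operatorname{ess\,sup}_{t\ge t_1}|a(t)|<1$, and $b(t)\ge 0$ for $t\ge 0$. (a3) $g(t)\le t$ for $t\ge0$, $\lim_{t\to\infty}g(t)=\infty$, and $g^{-1}(U)$ is a Lebesgue null set whenever $U\subset\mathbb R$ is. (a4) $h(t)\le t$ for $t\ge0$, $\lim_{t\to\infty}h(t)=\infty$, and $h^{-1}(U)$ is a Lebesgue null set whenever $U\subset\mathbb R$ is. (a6) There are $\delta,\tau>0$ and $t_2\ge0$ such that $t-g(t)\le\delta$ and $t-h(t)\le\tau$ for all $t\ge t_2$. Suppose moreover that there are $t_0\ge0$ and $b_0>0$ such that $$b(t)\ge b_0,\qquad \int_{\max\{h(t),0\}}^t b(s)\,ds\le\frac1e\quad\text{for all }t\ge t_0,\qquad\text{and}\qquad \operatorname*{ess\,sup}_{t\ge t_0}|a(t)|<\frac12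 .$$ Then $(*)$ is uniformly exponentially stable for initial times $\ge t_1$: there are $M>0$ and $\gamma>0$ such that, for every $s\ge t_1$, every bounded Borel measurable $\varphi:(-\infty,s]\to\mathbb R$ and every solution $x$ of $(*)$ on $[s,\infty)$ with $x(t)=\varphi(t)$ for $t\le s$, $$|x(t)|\le M e^{-\gamma(t-s)}\sup_{r\le s}|\varphi(r)|\quad\text{for almost every } t\ge s .$$ Here a solution is a Lebesgue measurable $x:\mathbb R\to\mathbb R$, essentially bounded on every bounded subinterval of $[0,\infty)$, such that $x=\varphi$ on $(-\infty,s]$ and there is a function $y$, absolutely continuous on $[s,T]$ for every $T\geq s$, with $y(s)=x(s)-a(s)x(g(s))$ and, for almost every $t\ge s$, $y(t)=x(t)-a(t)x(g(t))$ and $y'(t)=-b(t)x(h(t))$. -/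

import Mathlib

open MeasureTheory Set Filter Topology

/-- The norm `ess sup_{t ≥ t₀} |u t|` (Lebesgue measure), with values in `[0, ∞]`. -/
noncomputable def essNormFrom (u : ℝ → ℝ) (t₀ : ℝ) : ENNReal :=
  eLpNormEssSup u (volume.restrict (Ici t₀))

/-- Standing assumptions on a delayed argument `g : [0, ∞) → ℝ` (only the values at `t ≥ 0` matter):
it is Lebesgue measurable, `g t ≤ t`, `g t → ∞` as `t → ∞`, and preimages of null sets are null. -/
structure IsDelayedArgument (g : ℝ → ℝ) : Prop where
  measurable : AEMeasurable g (volume.restrict (Ici 0))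
  le_self : ∀ t, 0 ≤ t → g t ≤ t
  tendsto_atTop : Tendsto g atTop atTop
  null_preimage : ∀ U : Set ℝ, volume U = 0 → volume {t | 0 ≤ t ∧ g t ∈ U} = 0

/-- Standing assumptions on the coefficients `a, b : [0, ∞) → ℝ`: Lebesgue measurable, `a` bounded,
`b` nonnegative and essentially bounded, and `ess sup_{t ≥ t₁} |a t| < 1`.

The bound on `a` is required at every point because the initial value
`x s - a s * x (g s)` of a solution starting at `s` depends on the value of `a` at `s`. -/
structure AreCoefficients (a b : ℝ → ℝ) (t₁ : ℝ) : Prop where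
  measurable_a : AEMeasurable a (volume.restrict (Ici 0))
  measurable_b : AEMeasurable b (volume.restrict (Ici 0))
  bounded_a : ∃ A : ℝ, ∀ t, 0 ≤ t → |a t| ≤ A
  essBounded_b : essNormFrom b 0 < ⊤
  norm_a_lt_one : essNormFrom a t₁ < 1
  nonneg_b : ∀ t, 0 ≤ t → 0 ≤ b t

/-- The delays `t - g t` and `t - h t` are bounded for large `t`. -/
def BoundedDelays (g h : ℝ → ℝ) : Prop :=
  ∃ δ > 0, ∃ τ > 0, ∃ t₂ : ℝ, 0 ≤ t₂ ∧ ∀ t, t₂ ≤ t → t - g t ≤ δ ∧ t - h t ≤ τ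

/-- Admissible initial functions on `(-∞, s]`: Borel measurable and bounded. -/
structure IsInitialFunction (s : ℝ) (φ : ℝ → ℝ) : Prop where
  measurable : Measurable ((Iic s).domRestrict φ)
  bounded : BddAbove ((fun t => |φ t|) '' Iic s)

/-- `x : ℝ → ℝ` solves `(x(t) - a(t) x(g(t)))' + b(t) x(h(t)) = f(t)` for `t ≥ s`, with
`x(t) = φ(t)` for `t ≤ s`.

The function `y` is the locally absolutely continuous function `x - a · (x ∘ g)` on `[s, ∞)`; as
usual for measurable solutions, the identity is required almost everywhere and at the
initial point `s`. -/
structure IsSolution (a b g h f : ℝ → ℝ) (s : ℝ) (φ x : ℝ → ℝ) : Prop where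
  measurable : AEMeasurable x volume
  locally_essBounded : ∀ T : ℝ, ∃ C : ℝ, ∀ᵐ t, t ∈ Icc 0 T → |x t| ≤ C
  initial : ∀ t, t ≤ s → x t = φ t
  equation : ∃ y : ℝ → ℝ,
    (∀ T, s ≤ T → AbsolutelyContinuousOnInterval y s T) ∧
    y s = x s - a s * x (g s) ∧
    (∀ᵐ t, s ≤ t → y t = x t - a t * x (g t)) ∧
    (∀ᵐ t, s ≤ t → HasDerivAt y (f t - b t * x (h t)) t)

/-- Uniform exponential stability of `(x(t) - a(t) x(g(t)))' + b(t) x(h(t)) = 0`, for all initial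
times `s ≥ t₁`: the constants `M` and `γ` depend neither on `s` nor on the initial function `φ`.
Solutions are determined only up to null sets, so the estimate is for almost every `t`. -/
def ExponentiallyStableFrom (t₁ : ℝ) (a b g h : ℝ → ℝ) : Prop :=
  ∃ M > 0, ∃ γ > 0, ∀ s, t₁ ≤ s → ∀ φ : ℝ → ℝ, IsInitialFunction s φ →
    ∀ x : ℝ → ℝ, IsSolution a b g h (fun _ => 0) s φ x →
      ∀ᵐ t, s ≤ t →
        |x t| ≤ M * Real.exp (-γ * (t - s)) * sSup ((fun r => |φ r|) '' Iic s)

/-! With `y = x - a x(g)` the equation reads `y' = -b y(h) + b u`, where `u = y(h) - x(h) = -a(h)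
x(g(h))`. Since `∫ b` over a delay is at most `1 / e`, positivity propagates
(`nonneg_of_delay_inequality`), and comparison with an exponential bounds `y` by `sup |u| ≤ α sup
|x|`, up to a factor `b₀ / (b₀ - γ)` (`abs_le_exp_of_delay_equation`). Then `|x| ≤ |y| + α |x(g)|`
reproduces a bound on `x` with a factor near `2α < 1`. Bounded delays cost only factors such as `exp
(γ (δ + τ))`, so for small `γ` this is still a contraction in the weight `exp (-γ t)`
(`exists_decay_bound`).

The times before the hypotheses take effect fill an interval of length bounded uniformly in `s`;
there a crude growth estimate suffices (`exists_bound_on_initial_interval`). The circular estimates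
are closed by `of_contraction`: a finite bound exists, each bound yields a better one, and the limit
is the desired bound. -/

/-! ### Absolutely continuous functions. -/

theorem AbsolutelyContinuousOnInterval.le_of_ae_hasDerivAt_nonneg {f : ℝ → ℝ} {p q : ℝ}
    (hpq : p ≤ q) (hf : AbsolutelyContinuousOnInterval f p q)
    (hd : ∀ᵐ t, t ∈ Icc p q → ∃ d, HasDerivAt f d t ∧ 0 ≤ d) : f p ≤ f q := by
  have h := hf.integral_deriv_eq_sub
  have h0 : 0 ≤ ∫ t in p..q, deriv f t := by
    rw [intervalIntegral.integral_of_le hpq]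
    apply setIntegral_nonneg_of_ae_restrict
    rw [EventuallyLE, ae_restrict_iff' measurableSet_Ioc]
    filter_upwards [hd] with t ht htm
    obtain ⟨d, hd, hd0⟩ := ht (Ioc_subset_Icc_self htm)
    simpa [hd.deriv] using hd0
  linarith

theorem LipschitzOnWith.comp_absolutelyContinuousOnInterval {φ f : ℝ → ℝ} {K : NNReal} {s : Set ℝ}
    {p q : ℝ} (hφ : LipschitzOnWith K φ s) (hf : AbsolutelyContinuousOnInterval f p q)
    (hs : MapsTo f (uIcc p q) s) : AbsolutelyContinuousOnInterval (fun t => φ (f t)) p q := by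
  unfold AbsolutelyContinuousOnInterval at hf ⊢
  apply squeeze_zero' ?_ ?_ (by simpa using hf.const_mul (K : ℝ))
  · exact Filter.Eventually.of_forall fun _ => Finset.sum_nonneg fun i _ => dist_nonneg
  rw [eventually_inf_principal]
  filter_upwards with (n, I) hnI
  rw [Finset.mul_sum]
  refine Finset.sum_le_sum fun i hi => ?_
  simp only [AbsolutelyContinuousOnInterval.disjWithin, mem_ofPred_eq] at hnI
  exact hφ.dist_le_mul _ (hs (hnI.1 i hi).1) _ (hs (hnI.1 i hi).2)

theorem AbsolutelyContinuousOnInterval.exp {f : ℝ → ℝ} {p q : ℝ}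
    (hf : AbsolutelyContinuousOnInterval f p q) :
    AbsolutelyContinuousOnInterval (fun t => Real.exp (f t)) p q := by
  obtain ⟨C, hC⟩ := hf.exists_bound
  obtain ⟨K, hK⟩ := (Real.contDiff_exp (n := 1)).contDiffOn.exists_lipschitzOnWith
    (by decide) (convex_Icc (-C) C) isCompact_Icc
  exact hK.comp_absolutelyContinuousOnInterval hf fun t ht => abs_le.1 (hC t ht)

theorem absolutelyContinuousOnInterval_const_mul_exp (c l T p q : ℝ) :
    AbsolutelyContinuousOnInterval (fun t => c * Real.exp (l * (t - T))) p q :=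
  ContDiffOn.absolutelyContinuousOnInterval (by fun_prop)

theorem hasDerivAt_const_mul_exp (c l T t : ℝ) :
    HasDerivAt (fun t => c * Real.exp (l * (t - T))) (c * l * Real.exp (l * (t - T))) t := by
  have := ((((hasDerivAt_id t).sub_const T).const_mul l).exp).const_mul c
  simpa [mul_comm, mul_assoc, mul_left_comm] using this

/-! ### Contraction of bounds and almost-everywhere tools. -/

/-- A property that passes to limits and improves under the contraction towards `N` with factor `θ`
holds at `N`. -/
theorem of_contraction {P : ℝ → Prop} {θ N : ℝ} (hθ0 : 0 ≤ θ) (hθ1 : θ < 1)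
    (hstep : ∀ n, N ≤ n → P n → P (θ * n + (1 - θ) * N)) (hex : ∃ n, N ≤ n ∧ P n)
    (hclosed : ∀ u : ℕ → ℝ, (∀ n, P (u n)) → Tendsto u atTop (𝓝 N) → P N) : P N := by
  obtain ⟨m, hm, hPm⟩ := hex
  refine hclosed (fun n => θ ^ n * (m - N) + N) (fun n => ?_) ?_
  · induction n with
    | zero => simpa using hPm
    | succ n ih =>
      have := hstep _ (by nlinarith [mul_nonneg (pow_nonneg hθ0 n) (sub_nonneg.2 hm)]) ih
      convert this using 1
      ring
  · simpa using ((tendsto_pow_atTop_nhds_zero_of_lt_one hθ0 hθ1).mul_const (m - N)).add_const N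

/-- Only countably many exceptional null sets occur, so almost-everywhere bounds survive the limit
in `of_contraction`. -/
theorem ae_le_mul_of_tendsto {f w : ℝ → ℝ} {q : ℝ → Prop} {N : ℝ} (u : ℕ → ℝ)
    (hu : ∀ n, ∀ᵐ t, q t → f t ≤ u n * w t) (hN : Tendsto u atTop (𝓝 N)) :
    ∀ᵐ t, q t → f t ≤ N * w t := by
  filter_upwards [ae_all_iff.2 hu] with t ht hq
  exact ge_of_tendsto' (hN.mul_const (w t)) fun n => ht n hq

theorem ae_abs_le_of_essNormFrom_lt_top {u : ℝ → ℝ} {t₀ : ℝ} (h : essNormFrom u t₀ < ⊤) :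
    ∀ᵐ t, t₀ ≤ t → |u t| ≤ (essNormFrom u t₀).toReal := by
  have := ae_le_eLpNormEssSup (f := u) (μ := volume.restrict (Ici t₀))
  rw [ae_restrict_iff' measurableSet_Ici] at this
  filter_upwards [this] with t ht h0
  have := ENNReal.toReal_mono h.ne (ht h0)
  simpa using this

/-- Null preimages are what allow an almost-everywhere bound on `x` to be used for `x(g)` and
`x(h)`. -/
theorem IsDelayedArgument.ae_comp {g : ℝ → ℝ} (hg : IsDelayedArgument g) {p : ℝ → Prop}
    (hp : ∀ᵐ r, p r) : ∀ᵐ t, 0 ≤ t → p (g t) := by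
  have := hg.null_preimage {r | ¬ p r} hp
  rw [ae_iff]
  simpa using this

/-! ### Comparison for the non-neutral delay equation. -/

/-- Positivity for `z' ≥ -b z(k)` when `∫ b` over `[k t, t]` is at most `1 / e`: the function
`z · exp (e ∫ b)` is nondecreasing. -/
theorem nonneg_of_delay_inequality {b k z : ℝ → ℝ} {T R β : ℝ}
    (hTR : T ≤ R) (hb : IntervalIntegrable b volume T R) (hb0 : ∀ t ∈ Icc T R, 0 ≤ b t)
    (hbβ : ∀ᵐ t, t ∈ Icc T R → b t ≤ β) (hk : ∀ t ∈ Icc T R, k t ∈ Icc T t)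
    (hint : ∀ t ∈ Icc T R, ∫ r in k t..t, b r ≤ 1 / Real.exp 1)
    (hz : AbsolutelyContinuousOnInterval z T R) (hzT : 0 ≤ z T)
    (hd : ∀ᵐ t, t ∈ Icc T R → ∃ d, HasDerivAt z d t ∧ -(b t) * z (k t) ≤ d) :
    ∀ t ∈ Icc T R, 0 ≤ z t := by
  set e := Real.exp 1 with he
  have he0 : 0 < e := Real.exp_pos 1
  have hu : uIcc T R = Icc T R := uIcc_of_le hTR
  have hbi : ∀ p ∈ Icc T R, ∀ r ∈ Icc T R, IntervalIntegrable b volume p r := fun p hp r hr =>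
    hb.mono_set (by rw [hu]; exact uIcc_subset_Icc hp hr)
  set B : ℝ → ℝ := fun t => ∫ r in T..t, b r with hB
  set E : ℝ → ℝ := fun t => Real.exp (e * B t) with hE
  have hBac : AbsolutelyContinuousOnInterval B T R :=
    hb.absolutelyContinuousOnInterval_intervalIntegral (by simp)
  have hEac : AbsolutelyContinuousOnInterval E T R := (hBac.const_mul e).exp
  set q : ℝ → ℝ := fun t => E t * z t with hq
  have hqac : AbsolutelyContinuousOnInterval q T R := hEac.fun_mul hz
  have hEpos : ∀ t, 0 < E t := fun t => Real.exp_pos _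
  have hET : E T = 1 := by simp [hE, hB]
  set β' := max β 1
  have hβ' : 0 < β' := lt_of_lt_of_le one_pos (le_max_right _ _)
  -- With this rate the derivative of `S / 2 * X` is `e * β' * S * X`, exactly the error to absorb
  -- below.
  set l := 2 * e * β' with hl
  have hl0 : 0 < l := by positivity
  set X : ℝ → ℝ := fun t => Real.exp (l * (t - T)) with hX
  have hX0 : ∀ t, 0 < X t := fun t => Real.exp_pos _
  -- If `q` were monotone, `E z(k) ≤ e q` would give `q' ≥ 0`, which is circular. Monotonicity up to
  -- an error `S * X` is assumed instead; the same computation halves `S`.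
  have key : ∀ r ∈ Icc T R, ∀ t ∈ Icc T R, r ≤ t → q r - q t ≤ 0 * X t := by
    refine of_contraction (P := fun S => ∀ r ∈ Icc T R, ∀ t ∈ Icc T R, r ≤ t → q r - q t ≤ S * X t)
      (θ := 1 / 2) (N := 0) (by norm_num) (by norm_num) ?_ ?_ ?_
    · intro S hS hP r hr t ht hrt
      have hsub : Icc r t ⊆ Icc T R := Icc_subset_Icc hr.1 ht.2
      have hac : AbsolutelyContinuousOnInterval (fun t => q t + S / 2 * X t) r t :=
        (hqac.mono (by rwa [hu, uIcc_of_le hrt])).fun_add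
          (absolutelyContinuousOnInterval_const_mul_exp _ _ _ _ _)
      have := hac.le_of_ae_hasDerivAt_nonneg hrt ?_
      · nlinarith [mul_nonneg hS (hX0 r).le]
      filter_upwards [hd, hbβ, hb.ae_hasDerivAt_integral] with v hv1 hv2 hv3 hv
      have hv := hsub hv
      obtain ⟨d, hzd, hdl⟩ := hv1 hv
      have hv2 := hv2 hv
      have hBd : HasDerivAt B (b v) v := hv3 (hu ▸ hv) T (by simp)
      refine ⟨_, (((hBd.const_mul e).exp).mul hzd).add
        (hasDerivAt_const_mul_exp (S / 2) l T v), ?_⟩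
      change 0 ≤ E v * (e * b v) * z v + E v * d + S / 2 * l * X v
      have hkv := hk v hv
      have hkR : k v ∈ Icc T R := ⟨hkv.1, hkv.2.trans hv.2⟩
      have hT : T ∈ Icc T R := left_mem_Icc.2 hTR
      have hQk := hP _ hkR v hv hkv.2
      have hQT := hP T hT v hv hv.1
      have hqT : 0 ≤ q T := by simp [hq, hET, hzT]
      have hI := hint v hv
      have hsplit : B v = B (k v) + ∫ r in k v..v, b r :=
        (intervalIntegral.integral_add_adjacent_intervals (hbi _ hT _ hkR) (hbi _ hkR _ hv)).symm
      set c := Real.exp (e * ∫ r in k v..v, b r) with hc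
      have hc0 : 0 < c := Real.exp_pos _
      have hce : c ≤ e := by
        apply Real.exp_le_exp.2
        calc e * ∫ r in k v..v, b r ≤ e * (1 / e) := by gcongr
          _ = 1 := by field_simp
      have hEE : E v = E (k v) * c := by
        simp only [hE, hc]; rw [← Real.exp_add, hsplit]; ring_nf
      have h1 : E v * z (k v) ≤ e * (q v + S * X v) := by
        calc E v * z (k v) = c * q (k v) := by rw [hEE]; simp only [hq]; ring
          _ ≤ c * (q v + S * X v) := by gcongr; linarith
          _ ≤ e * (q v + S * X v) := by gcongr; linarith
      have h2 : b v * (E v * z (k v)) ≤ b v * (e * (q v + S * X v)) :=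
        mul_le_mul_of_nonneg_left h1 (hb0 v hv)
      have h3 : E v * (-(b v) * z (k v)) ≤ E v * d := mul_le_mul_of_nonneg_left hdl (hEpos v).le
      have h4 : b v * (e * (S * X v)) ≤ β' * (e * (S * X v)) :=
        mul_le_mul_of_nonneg_right (hv2.trans (le_max_left _ _))
          (mul_nonneg he0.le (mul_nonneg hS (hX0 v).le))
      have h5 : S / 2 * l * X v = β' * (e * (S * X v)) := by rw [hl]; ring
      have h6 : E v * (e * b v) * z v = b v * (e * q v) := by simp only [hq]; ring
      rw [h5, h6]
      linarith
    · obtain ⟨C, hC⟩ := hqac.exists_bound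
      rw [hu] at hC
      have hC0 : 0 ≤ C := (norm_nonneg _).trans (hC T (left_mem_Icc.2 hTR))
      refine ⟨2 * C, by positivity, fun r hr t ht _ => ?_⟩
      have h1 := abs_le.1 (hC r hr)
      have h2 := abs_le.1 (hC t ht)
      have h3 : 1 ≤ X t := Real.one_le_exp (mul_nonneg hl0.le (sub_nonneg.2 ht.1))
      nlinarith
    · intro u hu hlim r hr t ht hrt
      exact ge_of_tendsto' (hlim.mul_const (X t)) fun n => hu n r hr t ht hrt
  intro t ht
  have h := key T (left_mem_Icc.2 hTR) t ht ht.1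
  have hqt : 0 ≤ E t * z t := by
    have : q T = z T := by simp [hq, hET]
    have h' : q t = E t * z t := rfl
    linarith
  exact nonneg_of_mul_nonneg_right hqt (hEpos t)

/-- Solutions of `y' = -b y(k) + b u` inherit exponential decay from `u`, with a constant that tends
to `1` as the rate `γ` tends to `0`. -/
theorem abs_le_exp_of_delay_equation {b k u y : ℝ → ℝ} {T R β b₀ γ L : ℝ}
    (hTR : T ≤ R) (hb : IntervalIntegrable b volume T R) (hb0 : ∀ t ∈ Icc T R, b₀ ≤ b t)
    (hbβ : ∀ᵐ t, t ∈ Icc T R → b t ≤ β) (hk : ∀ t ∈ Icc T R, k t ∈ Icc T t)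
    (hint : ∀ t ∈ Icc T R, ∫ r in k t..t, b r ≤ 1 / Real.exp 1)
    (hγ : 0 ≤ γ) (hγb : γ < b₀) (hL : 0 ≤ L)
    (hy : AbsolutelyContinuousOnInterval y T R) (hyT : |y T| ≤ b₀ / (b₀ - γ) * L)
    (hd : ∀ᵐ t, t ∈ Icc T R → HasDerivAt y (-(b t) * y (k t) + b t * u t) t ∧
      |u t| ≤ L * Real.exp (-γ * (t - T))) :
    ∀ t ∈ Icc T R, |y t| ≤ b₀ / (b₀ - γ) * L * Real.exp (-γ * (t - T)) := by
  -- `W` solves `W γ + b₀ L = b₀ W`, which makes `W exp (-γ (t - T))` a supersolution.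
  set W := b₀ / (b₀ - γ) * L with hW
  have hpos : 0 < b₀ - γ := sub_pos.2 hγb
  have hW0 : 0 ≤ W := by have := hγ.trans hγb.le; positivity
  have hWL : W * (b₀ - γ) = b₀ * L := by rw [hW]; field_simp
  have hLW : L ≤ W := by
    by_contra! hlt
    nlinarith [mul_nonneg hγ hL]
  have upper : ∀ (y u : ℝ → ℝ), AbsolutelyContinuousOnInterval y T R → |y T| ≤ W →
      (∀ᵐ t, t ∈ Icc T R → HasDerivAt y (-(b t) * y (k t) + b t * u t) t ∧
        |u t| ≤ L * Real.exp (-γ * (t - T))) →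
      ∀ t ∈ Icc T R, y t ≤ W * Real.exp (-γ * (t - T)) := by
    intro y u hy hyT hd t ht
    have := nonneg_of_delay_inequality (z := fun t => W * Real.exp (-γ * (t - T)) - y t)
      hTR hb (fun t ht => (hγ.trans hγb.le).trans (hb0 t ht)) hbβ hk hint
      ((absolutelyContinuousOnInterval_const_mul_exp _ _ _ _ _).fun_sub hy)
      (by simpa using (abs_le.1 hyT).2) ?_ t ht
    · linarith
    filter_upwards [hd] with v hv hvm
    obtain ⟨hyd, huv⟩ := hv hvm
    refine ⟨_, (hasDerivAt_const_mul_exp W (-γ) T v).sub hyd, ?_⟩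
    have hbv := hb0 v hvm
    have hX : Real.exp (-γ * (v - T)) ≤ Real.exp (-γ * (k v - T)) := by
      apply Real.exp_le_exp.2
      nlinarith [(hk v hvm).2]
    have hX0 := Real.exp_pos (-γ * (v - T))
    set X := Real.exp (-γ * (v - T))
    set Y := Real.exp (-γ * (k v - T))
    have hb00 : 0 ≤ b v := (hγ.trans hγb.le).trans hbv
    have h1 : b v * u v ≤ b v * (L * X) := by gcongr; exact (abs_le.1 huv).2
    have h2 : b v * (W * X) ≤ b v * (W * Y) := by gcongr
    have h3 : (W * γ + b v * L) * X ≤ (b v * W) * X := by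
      gcongr
      nlinarith [mul_nonneg (sub_nonneg.2 hbv) (sub_nonneg.2 hLW)]
    nlinarith
  intro t ht
  refine abs_le.2 ⟨?_, upper y u hy hyT hd t ht⟩
  have := upper (fun t => -y t) (fun t => -u t) hy.fun_neg (by simpa using hyT) ?_ t ht
  · linarith
  filter_upwards [hd] with v hv hvm
  obtain ⟨hyd, huv⟩ := hv hvm
  refine ⟨?_, by simpa using huv⟩
  exact hyd.fun_neg.congr_deriv (by ring)

/-! ### Growth on an initial interval. -/

/-- On `[s, T]` with `T - s` bounded, solutions are bounded by a fixed multiple of a bound `K` for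
their initial function. -/
theorem exists_bound_on_initial_interval {a b g h : ℝ → ℝ} {t₁ : ℝ} (ht₁ : 0 ≤ t₁)
    (hab : AreCoefficients a b t₁) (hg : IsDelayedArgument g) (hh : IsDelayedArgument h) (D : ℝ) :
    ∃ C > 0, ∀ s T K : ℝ, ∀ x y : ℝ → ℝ, t₁ ≤ s → s ≤ T → T ≤ s + D →
      (∀ r, r ≤ s → |x r| ≤ K) → (∃ c, ∀ᵐ t, t ∈ Icc 0 T → |x t| ≤ c) →
      AbsolutelyContinuousOnInterval y s T → y s = x s - a s * x (g s) →
      (∀ᵐ t, s ≤ t → y t = x t - a t * x (g t)) →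
      (∀ᵐ t, s ≤ t → HasDerivAt y (-(b t) * x (h t)) t) →
      (∀ᵐ r, r ≤ T → |x r| ≤ C * K) ∧ |y T| ≤ C * K := by
  obtain ⟨A, hA⟩ := hab.bounded_a
  have hA0 : 0 ≤ A := (abs_nonneg _).trans (hA 0 le_rfl)
  have haα := ae_abs_le_of_essNormFrom_lt_top (hab.norm_a_lt_one.trans ENNReal.one_lt_top)
  set α := (essNormFrom a t₁).toReal
  have hα0 : 0 ≤ α := ENNReal.toReal_nonneg
  have hα1 : α < 1 := by
    simpa using (ENNReal.toReal_lt_toReal (hab.norm_a_lt_one.trans ENNReal.one_lt_top).ne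
      ENNReal.one_ne_top).2 hab.norm_a_lt_one
  obtain ⟨β, hβ0, hbβ⟩ : ∃ β > 0, ∀ᵐ t, (0 : ℝ) ≤ t → |b t| ≤ β := by
    refine ⟨max (essNormFrom b 0).toReal 1, lt_of_lt_of_le one_pos (le_max_right _ _), ?_⟩
    filter_upwards [ae_abs_le_of_essNormFrom_lt_top hab.essBounded_b] with t ht h0
    exact (ht h0).trans (le_max_left _ _)
  have h1α : 0 < 1 - α := sub_pos.2 hα1
  -- Integrating `β X` gains `β / l = (1 - α) / 2`, so the total factor `α + β / l` is `θ < 1`.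
  set l := 2 * β / (1 - α) with hl
  have hl0 : 0 < l := by positivity
  set θ := (1 + α) / 2 with hθ
  have hθ1 : 0 < 1 - θ := by rw [hθ]; linarith
  have hβl : β / l = θ - α := by rw [hl, hθ]; field_simp; ring
  refine ⟨(1 + A) / (1 - θ) * Real.exp (l * D), by positivity, ?_⟩
  intro s T K x y hs hsT hTD hxK hxb hyac hys hyx hyd
  have hs0 : 0 ≤ s := ht₁.trans hs
  have hK : 0 ≤ K := (abs_nonneg _).trans (hxK s le_rfl)
  -- The fixed point of `N ↦ θ N + (1 + A) K`.
  set N₀ := (1 + A) / (1 - θ) * K with hN₀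
  have hN₀θ : (1 - θ) * N₀ = (1 + A) * K := by rw [hN₀]; field_simp
  have hKN : K ≤ N₀ := by
    rw [hN₀]
    apply le_mul_of_one_le_left hK
    rw [le_div_iff₀ hθ1, hθ]
    linarith
  set X : ℝ → ℝ := fun t => Real.exp (l * (t - s)) with hX
  have hX1 : ∀ t, s ≤ t → 1 ≤ X t := fun t ht =>
    Real.one_le_exp (mul_nonneg hl0.le (sub_nonneg.2 ht))
  have hXmono : ∀ r t, r ≤ t → X r ≤ X t := fun r t hrt =>
    Real.exp_le_exp.2 (mul_le_mul_of_nonneg_left (by linarith) hl0.le)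
  have delayed : ∀ N, N₀ ≤ N → (∀ᵐ t, t ∈ Icc s T → |x t| ≤ N * X t) → ∀ k : ℝ → ℝ,
      IsDelayedArgument k → ∀ᵐ t, t ∈ Icc s T → |x (k t)| ≤ N * X t := by
    intro N hN hP k hk
    filter_upwards [hk.ae_comp hP] with t ht htm
    have ht0 : 0 ≤ t := hs0.trans htm.1
    have hN0 : 0 ≤ N := hK.trans (hKN.trans hN)
    have hkt := hk.le_self t ht0
    rcases le_total (k t) s with hks | hks
    · exact (hxK _ hks).trans ((hKN.trans hN).trans (le_mul_of_one_le_right hN0 (hX1 t htm.1)))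
    · exact (ht ht0 ⟨hks, hkt.trans htm.2⟩).trans
        (mul_le_mul_of_nonneg_left (hXmono _ _ hkt) hN0)
  have hysb : |y s| ≤ (1 + A) * K := by
    rw [hys]
    calc |x s - a s * x (g s)| ≤ |x s| + |a s * x (g s)| := abs_sub _ _
      _ = |x s| + |a s| * |x (g s)| := by rw [abs_mul]
      _ ≤ K + A * K := add_le_add (hxK s le_rfl)
          (mul_le_mul (hA s hs0) (hxK _ (hg.le_self s hs0)) (abs_nonneg _) hA0)
      _ = (1 + A) * K := by ring
  have ybound : ∀ N, N₀ ≤ N → (∀ᵐ t, t ∈ Icc s T → |x t| ≤ N * X t) →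
      ∀ t ∈ Icc s T, |y t| ≤ (1 + A) * K + (θ - α) * N * X t := by
    intro N hN hP t ht
    have hN0 : 0 ≤ N := hK.trans (hKN.trans hN)
    have hac := hyac.mono (c := s) (d := t)
      (by rw [uIcc_of_le hsT, uIcc_of_le ht.1]; exact Icc_subset_Icc le_rfl ht.2)
    have hac' := absolutelyContinuousOnInterval_const_mul_exp ((θ - α) * N) l s s t
    have hD : ∀ᵐ v, v ∈ Icc s t →
        HasDerivAt y (-(b v) * x (h v)) v ∧ |-(b v) * x (h v)| ≤ (θ - α) * N * l * X v := by
      filter_upwards [hyd, hbβ, delayed N hN hP h hh] with v hv1 hv2 hv3 hv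
      refine ⟨hv1 hv.1, ?_⟩
      rw [abs_mul, abs_neg]
      calc |b v| * |x (h v)| ≤ β * (N * X v) :=
            mul_le_mul (hv2 (hs0.trans hv.1)) (hv3 ⟨hv.1, hv.2.trans ht.2⟩) (abs_nonneg _) hβ0.le
        _ = (θ - α) * N * l * X v := by rw [← hβl]; field_simp
    have up := (hac'.fun_sub hac).le_of_ae_hasDerivAt_nonneg ht.1 (by
      filter_upwards [hD] with v hv hvm
      exact ⟨_, (hasDerivAt_const_mul_exp ((θ - α) * N) l s v).sub (hv hvm).1,
        sub_nonneg.2 (abs_le.1 (hv hvm).2).2⟩)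
    have lo := (hac'.fun_add hac).le_of_ae_hasDerivAt_nonneg ht.1 (by
      filter_upwards [hD] with v hv hvm
      exact ⟨_, (hasDerivAt_const_mul_exp ((θ - α) * N) l s v).add (hv hvm).1,
        neg_le_iff_add_nonneg'.1 (abs_le.1 (hv hvm).2).1⟩)
    have hp : 0 ≤ (θ - α) * N := mul_nonneg (by rw [← hβl]; positivity) hN0
    simp only [sub_self, mul_zero, Real.exp_zero, mul_one] at up lo
    have := abs_le.1 hysb
    exact abs_le.2 ⟨by simp only [hX]; linarith, by simp only [hX]; linarith⟩
  have hfin : ∀ᵐ t, t ∈ Icc s T → |x t| ≤ N₀ * X t := by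
    refine of_contraction (P := fun N => ∀ᵐ t, t ∈ Icc s T → |x t| ≤ N * X t) (θ := θ)
      (by positivity) (by linarith) ?_ ?_ ?_
    · intro N hN hP
      filter_upwards [haα, hyx, delayed N hN hP g hg] with t ht1 ht2 ht3 ht
      have hy := ybound N hN hP t ht
      have hxe : x t = y t + a t * x (g t) := by rw [ht2 ht.1]; ring
      calc |x t| ≤ |y t| + |a t| * |x (g t)| := by
            rw [hxe, ← abs_mul]; exact abs_add_le _ _
        _ ≤ ((1 + A) * K + (θ - α) * N * X t) + α * (N * X t) := add_le_add hy
            (mul_le_mul (ht1 (hs.trans ht.1)) (ht3 ht) (abs_nonneg _) hα0)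
        _ ≤ (1 + A) * K * X t + (θ - α) * N * X t + α * (N * X t) := by
            have := le_mul_of_one_le_right (mul_nonneg (by positivity : 0 ≤ 1 + A) hK) (hX1 t ht.1)
            linarith
        _ = (θ * N + (1 - θ) * N₀) * X t := by rw [hN₀θ]; ring
    · obtain ⟨c, hc⟩ := hxb
      refine ⟨max c N₀, le_max_right _ _, ?_⟩
      filter_upwards [hc] with t ht htm
      exact ((ht ⟨hs0.trans htm.1, htm.2⟩).trans (le_max_left _ _)).trans
        (le_mul_of_one_le_right ((hK.trans hKN).trans (le_max_right _ _)) (hX1 t htm.1))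
    · intro u hu hlim
      exact ae_le_mul_of_tendsto u hu hlim
  have hXD : ∀ t, t ≤ T → X t ≤ Real.exp (l * D) := fun t ht =>
    Real.exp_le_exp.2 (mul_le_mul_of_nonneg_left (by linarith) hl0.le)
  have hN₀0 := hK.trans hKN
  have hCK : (1 + A) / (1 - θ) * Real.exp (l * D) * K = N₀ * Real.exp (l * D) := by
    rw [hN₀]; ring
  rw [hCK]
  constructor
  · filter_upwards [hfin] with r hr hrT
    rcases le_total r s with hrs | hrs
    · exact ((hxK r hrs).trans hKN).trans (le_mul_of_one_le_right hN₀0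
        ((hX1 T hsT).trans (hXD T le_rfl)))
    · exact (hr ⟨hrs, hrT⟩).trans (mul_le_mul_of_nonneg_left (hXD r hrT) hN₀0)
  · refine (ybound N₀ le_rfl hfin T (right_mem_Icc.2 hsT)).trans ?_
    refine le_trans ?_ (mul_le_mul_of_nonneg_left (hXD T le_rfl) hN₀0)
    rw [← hN₀θ]
    have := hX1 T hsT
    nlinarith [mul_nonneg (mul_nonneg hθ1.le hN₀0) (sub_nonneg.2 this),
      mul_nonneg (mul_nonneg hα0 hN₀0) (zero_le_one.trans this)]

/-! ### Exponential decay by contraction. -/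

/-- Exponential decay after a time `T` from which all the hypotheses on the coefficients hold, in
terms of a bound `K` for `x` before `T` and for `y T`. -/
theorem exists_decay_bound {a b g h : ℝ → ℝ} {T₀ b₀ α δ τ : ℝ} (hT₀ : 0 ≤ T₀)
    (hbm : AEMeasurable b (volume.restrict (Ici 0))) (hbβ : essNormFrom b 0 < ⊤)
    (hg : IsDelayedArgument g) (hh : IsDelayedArgument h)
    (hb₀ : 0 < b₀) (hb : ∀ t, T₀ ≤ t → b₀ ≤ b t) (hbnn : ∀ t, 0 ≤ t → 0 ≤ b t)
    (hint : ∀ t, T₀ ≤ t → ∫ r in (max (h t) 0)..t, b r ≤ 1 / Real.exp 1)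
    (hα0 : 0 ≤ α) (hα : α < 1 / 2) (haα : ∀ᵐ t, T₀ ≤ t → |a t| ≤ α)
    (hδ : 0 ≤ δ) (hτ : 0 ≤ τ) (hdelay : ∀ t, T₀ ≤ t → t - g t ≤ δ ∧ t - h t ≤ τ) :
    ∃ C > 0, ∃ γ > 0, ∀ T K : ℝ, ∀ x y : ℝ → ℝ, T₀ ≤ T →
      (∀ᵐ r, r ≤ T → |x r| ≤ K) → |y T| ≤ K →
      (∀ R, ∃ c, ∀ᵐ t, t ∈ Icc 0 R → |x t| ≤ c) →
      (∀ R, T ≤ R → AbsolutelyContinuousOnInterval y T R) →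
      (∀ᵐ t, T ≤ t → y t = x t - a t * x (g t)) →
      (∀ᵐ t, T ≤ t → HasDerivAt y (-(b t) * x (h t)) t) →
      ∀ᵐ t, T ≤ t → |x t| ≤ C * K * Real.exp (-γ * (t - T)) := by
  obtain ⟨γ, ⟨hγ0, hγb⟩, hγθ⟩ : ∃ γ, (0 < γ ∧ γ < b₀) ∧
      b₀ / (b₀ - γ) * (α * Real.exp (γ * (δ + τ))) + α * Real.exp (γ * δ) < 1 := by
    -- At `γ = 0` the expression equals `2α < 1`.
    have hcont : ContinuousAt (fun γ => b₀ / (b₀ - γ) * (α * Real.exp (γ * (δ + τ))) +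
        α * Real.exp (γ * δ)) 0 := by
      have : b₀ - 0 ≠ 0 := by simpa using hb₀.ne'
      fun_prop (disch := assumption)
    have h1 := hcont.eventually_lt (continuousAt_const (y := (1 : ℝ)))
      (by simp [hb₀.ne']; linarith)
    have h2 := (h1.filter_mono nhdsWithin_le_nhds).and (Ioo_mem_nhdsGT hb₀)
    obtain ⟨γ, h, h'⟩ := h2.exists
    exact ⟨γ, h', h⟩
  set V := b₀ / (b₀ - γ) with hV
  have hbγ : 0 < b₀ - γ := sub_pos.2 hγb
  have hV1 : 1 ≤ V := by rw [hV, le_div_iff₀ hbγ]; linarith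
  set θ := V * (α * Real.exp (γ * (δ + τ))) + α * Real.exp (γ * δ) with hθ
  have hθ0 : 0 ≤ θ := by positivity
  have hθ1 : 0 < 1 - θ := sub_pos.2 hγθ
  refine ⟨2 * V * Real.exp (γ * τ) / (1 - θ), by positivity, γ, hγ0, ?_⟩
  intro T K x y hT hxK hyK hxb hyac hyx hyd
  have hT0 : 0 ≤ T := hT₀.trans hT
  have hK : 0 ≤ K := (abs_nonneg _).trans hyK
  have hexpτ : 1 ≤ Real.exp (γ * τ) := Real.one_le_exp (by positivity)
  set N₀ := 2 * V * Real.exp (γ * τ) / (1 - θ) * K with hN₀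
  have hN₀θ : (1 - θ) * N₀ = V * (2 * K * Real.exp (γ * τ)) := by rw [hN₀]; field_simp
  have hKN : K ≤ N₀ := by
    rw [hN₀]
    apply le_mul_of_one_le_left hK
    rw [le_div_iff₀ hθ1]
    nlinarith [mul_le_mul hV1 hexpτ zero_le_one (zero_le_one.trans hV1)]
  set X : ℝ → ℝ := fun t => Real.exp (-γ * (t - T)) with hX
  have hX0 : ∀ t, 0 < X t := fun t => Real.exp_pos _
  have hXle : ∀ r t c : ℝ, t - r ≤ c → X r ≤ Real.exp (γ * c) * X t := by
    intro r t c hrt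
    rw [hX, ← Real.exp_add]
    apply Real.exp_le_exp.2
    nlinarith [mul_le_mul_of_nonneg_left hrt hγ0.le]
  -- The contraction needs a finite starting bound, available only on bounded intervals; `N₀` does
  -- not depend on `n`.
  suffices hfin : ∀ n : ℕ, ∀ᵐ t, t ∈ Icc T (T + n) → |x t| ≤ N₀ * X t by
    filter_upwards [ae_all_iff.2 hfin] with t ht htT
    obtain ⟨n, hn⟩ := exists_nat_ge (t - T)
    exact ht n ⟨htT, by linarith⟩
  intro n
  set R := T + n
  have hTR : T ≤ R := le_add_of_nonneg_right n.cast_nonneg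
  have hbint : ∀ p r, 0 ≤ p → 0 ≤ r → IntervalIntegrable b volume p r := by
    intro p r hp hr
    have hm : AEStronglyMeasurable b (volume.restrict (Ici 0)) := hbm.aestronglyMeasurable
    have hsub : uIoc p r ⊆ Ici 0 := fun v hv => (le_min hp hr).trans hv.1.le
    rw [intervalIntegrable_iff]
    refine IntegrableOn.of_bound measure_Ioc_lt_top
      (hm.mono_measure (Measure.restrict_mono hsub le_rfl)) (essNormFrom b 0).toReal ?_
    · rw [ae_restrict_iff' measurableSet_Ioc]
      filter_upwards [ae_abs_le_of_essNormFrom_lt_top hbβ] with v hv hvm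
      exact hv (hsub hvm)
  have delayed : ∀ N, N₀ ≤ N → (∀ᵐ t, t ∈ Icc T R → |x t| ≤ N * X t) →
      ∀ᵐ r, r ≤ R → ∀ t c, T ≤ t → t - r ≤ c → 0 ≤ c → |x r| ≤ N * (Real.exp (γ * c) * X t) := by
    intro N hN hP
    filter_upwards [hP, hxK] with r hr1 hr2 hrR t c ht hrt hc
    have hN0 : 0 ≤ N := hK.trans (hKN.trans hN)
    rcases le_total r T with hrT | hrT
    · have h1 : 1 ≤ Real.exp (γ * c) * X t := by
        simpa [hX] using hXle T t c (by linarith)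
      exact ((hr2 hrT).trans (hKN.trans hN)).trans (le_mul_of_one_le_right hN0 h1)
    · exact (hr1 ⟨hrT, hrR⟩).trans (mul_le_mul_of_nonneg_left (hXle r t c hrt) hN0)
  refine of_contraction (P := fun N => ∀ᵐ t, t ∈ Icc T R → |x t| ≤ N * X t) (θ := θ)
    hθ0 hγθ ?_ ?_ ?_
  · intro N hN hP
    have hN0 : 0 ≤ N := hK.trans (hKN.trans hN)
    have hdel := delayed N hN hP
    -- `y` is controlled only from `T` on, so the delay is truncated there; when `h t < T` the
    -- discrepancy `y T - x (h t)` goes into `u` and costs `2 * K`.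
    set k : ℝ → ℝ := fun t => max (h t) T
    set L := α * (N * Real.exp (γ * (δ + τ))) + 2 * K * Real.exp (γ * τ) with hL
    have hL0 : 0 ≤ L := by positivity
    have hKL : K ≤ V * L := by
      have h1 : K ≤ L := by
        have : 0 ≤ α * (N * Real.exp (γ * (δ + τ))) := by positivity
        nlinarith
      exact h1.trans (le_mul_of_one_le_left hL0 hV1)
    have hgdel := hg.ae_comp hdel
    have hy := abs_le_exp_of_delay_equation (b := b) (k := k) (u := fun t => y (k t) - x (h t))
      (y := y) (T := T) (R := R) (β := (essNormFrom b 0).toReal) (b₀ := b₀) (γ := γ) (L := L)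
      hTR (hbint _ _ hT0 (hT0.trans hTR)) (fun t ht => hb t (hT.trans ht.1)) ?_ ?_ ?_ hγ0.le hγb hL0
      (hyac R hTR) (hyK.trans hKL) ?_
    · filter_upwards [haα, hyx, hgdel] with t ht1 ht2 ht3 ht
      have ht0 := hT0.trans ht.1
      have hgt := ht3 ht0 ((hg.le_self t ht0).trans ht.2) t δ ht.1 (hdelay t (hT.trans ht.1)).1 hδ
      have hxe : x t = y t + a t * x (g t) := by rw [ht2 ht.1]; ring
      calc |x t| ≤ |y t| + |a t| * |x (g t)| := by
            rw [hxe, ← abs_mul]; exact abs_add_le _ _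
        _ ≤ V * L * X t + α * (N * (Real.exp (γ * δ) * X t)) := add_le_add (hy t ht)
            (mul_le_mul (ht1 (hT.trans ht.1)) hgt (abs_nonneg _) hα0)
        _ = (θ * N + (1 - θ) * N₀) * X t := by rw [hN₀θ, hL, hθ]; ring
    · filter_upwards [ae_abs_le_of_essNormFrom_lt_top hbβ] with t ht htm
      exact (le_abs_self _).trans (ht (hT0.trans htm.1))
    · exact fun t ht => ⟨le_max_right _ _, max_le (hh.le_self t (hT0.trans ht.1)) ht.1⟩
    · intro t ht
      have ht0 := hT0.trans ht.1
      have hkt : k t ≤ t := max_le (hh.le_self t ht0) ht.1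
      have hk0 : max (h t) 0 ≤ k t := max_le_max le_rfl hT0
      have h0 : 0 ≤ max (h t) 0 := le_max_right _ _
      refine le_trans ?_ (hint t (hT.trans ht.1))
      rw [← intervalIntegral.integral_add_adjacent_intervals
        (hbint _ _ h0 (h0.trans hk0)) (hbint _ t (h0.trans hk0) ht0)]
      exact le_add_of_nonneg_left (intervalIntegral.integral_nonneg hk0
        fun v hv => hbnn v (h0.trans hv.1))
    · filter_upwards [hyd, hh.ae_comp (hyx.and (haα.and hxK)), hh.ae_comp hgdel]
        with t ht1 ht2 ht3 ht
      have ht0 := hT0.trans ht.1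
      refine ⟨(ht1 ht.1).congr_deriv (by ring), ?_⟩
      obtain ⟨hyh, hah, hxh⟩ := ht2 ht0
      obtain ⟨-, hd⟩ := hdelay t (hT.trans ht.1)
      have hht := hh.le_self t ht0
      change _ ≤ L * X t
      rcases le_or_gt T (h t) with hTh | hTh
      · have hk : k t = h t := max_eq_left hTh
        have hgh := hg.le_self (h t) (hT0.trans hTh)
        have hgx := ht3 ht0 (hT0.trans hTh) ((hgh.trans hht).trans ht.2) t (δ + τ) ht.1
          (by linarith [(hdelay (h t) (hT.trans hTh)).1]) (by positivity)
        calc |y (k t) - x (h t)| = |a (h t)| * |x (g (h t))| := by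
              rw [hk, hyh hTh, ← abs_mul, ← abs_neg]; ring_nf
          _ ≤ α * (N * (Real.exp (γ * (δ + τ)) * X t)) :=
              mul_le_mul (hah (hT.trans hTh)) hgx (abs_nonneg _) hα0
          _ = α * (N * Real.exp (γ * (δ + τ))) * X t := by ring
          _ ≤ L * X t := by
              apply mul_le_mul_of_nonneg_right _ (hX0 t).le
              rw [hL]
              exact le_add_of_nonneg_right (by positivity)
      · have hk : k t = T := max_eq_right hTh.le
        have h1 : 1 ≤ Real.exp (γ * τ) * X t := by
          simpa [hX] using hXle T t τ (by linarith)
        calc |y (k t) - x (h t)| ≤ |y (k t)| + |x (h t)| := abs_sub _ _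
          _ ≤ K + K := add_le_add (hk ▸ hyK) (hxh hTh.le)
          _ = 2 * K := by ring
          _ ≤ 2 * K * (Real.exp (γ * τ) * X t) := le_mul_of_one_le_right (by positivity) h1
          _ = 2 * K * Real.exp (γ * τ) * X t := by ring
          _ ≤ L * X t := by
              apply mul_le_mul_of_nonneg_right _ (hX0 t).le
              rw [hL]
              exact le_add_of_nonneg_left (by positivity)
  · obtain ⟨c, hc⟩ := hxb R
    have hXR : ∀ t, t ∈ Icc T R → 1 ≤ Real.exp (γ * n) * X t := fun t ht => by
      simpa [hX] using hXle T t n (by linarith [ht.2])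
    refine ⟨max c N₀ * Real.exp (γ * n), ?_, ?_⟩
    · exact (le_max_right c N₀).trans (le_mul_of_one_le_right
        ((hK.trans hKN).trans (le_max_right _ _)) (Real.one_le_exp (by positivity)))
    · filter_upwards [hc] with t ht htm
      rw [mul_assoc]
      exact ((ht ⟨hT0.trans htm.1, htm.2⟩).trans (le_max_left c N₀)).trans
        (le_mul_of_one_le_right ((hK.trans hKN).trans (le_max_right _ _)) (hXR t htm))
  · intro u hu hlim
    exact ae_le_mul_of_tendsto u hu hlim

/-! ### Uniform exponential stability. -/

theorem theorem1 (a b g h : ℝ → ℝ) (t₁ : ℝ) (ht₁ : 0 ≤ t₁)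
    (hab : AreCoefficients a b t₁)
    (hg : IsDelayedArgument g) (hh : IsDelayedArgument h)
    (hdelay : BoundedDelays g h)
    (hmain : ∃ t₀ : ℝ, 0 ≤ t₀ ∧
      (∃ b₀ : ℝ, 0 < b₀ ∧ ∀ t, t₀ ≤ t → b₀ ≤ b t) ∧
      (∀ t, t₀ ≤ t → ∫ r in (max (h t) 0)..t, b r ≤ 1 / Real.exp 1) ∧
      essNormFrom a t₀ < 1 / 2) :
    ExponentiallyStableFrom t₁ a b g h := by
  obtain ⟨δ, hδ, τ, hτ, t₂, ht₂, hdel⟩ := hdelay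
  obtain ⟨t₀, ht₀, ⟨b₀, hb₀, hb⟩, hint, ha⟩ := hmain
  have hatop : essNormFrom a t₀ < ⊤ := ha.trans_le le_top
  have haα := ae_abs_le_of_essNormFrom_lt_top hatop
  have hα : (essNormFrom a t₀).toReal < 1 / 2 := by
    simpa using (ENNReal.toReal_lt_toReal hatop.ne (by simp)).2 ha
  set D := max t₀ t₂
  have hD0 : 0 ≤ D := ht₀.trans (le_max_left _ _)
  obtain ⟨C₁, hC₁, H₁⟩ := exists_bound_on_initial_interval ht₁ hab hg hh D
  obtain ⟨C₂, hC₂, γ, hγ, H₂⟩ := exists_decay_bound (a := a) (T₀ := D) hD0 hab.measurable_b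
    hab.essBounded_b hg hh hb₀ (fun t ht => hb t ((le_max_left _ _).trans ht)) hab.nonneg_b
    (fun t ht => hint t ((le_max_left _ _).trans ht)) ENNReal.toReal_nonneg hα
    (by filter_upwards [haα] with t ht h; exact ht ((le_max_left _ _).trans h))
    hδ.le hτ.le (fun t ht => hdel t ((le_max_right _ _).trans ht))
  -- `exp (γ * D)` pays for measuring decay from `s` instead of `T ≤ s + D`; `C₂ + 1` covers both `t
  -- ≤ T` and `t ≥ T`.
  refine ⟨(C₂ + 1) * C₁ * Real.exp (γ * D), by positivity, γ, hγ, ?_⟩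
  intro s hs φ hφ x hx
  obtain ⟨y, hyac, hys, hyx, hyd⟩ := hx.equation
  have hs0 : 0 ≤ s := ht₁.trans hs
  set K := sSup ((fun r => |φ r|) '' Iic s)
  have hxK : ∀ r, r ≤ s → |x r| ≤ K := fun r hr => by
    rw [hx.initial r hr]
    exact le_csSup hφ.bounded (mem_image_of_mem _ hr)
  have hK : 0 ≤ K := (abs_nonneg _).trans (hxK s le_rfl)
  have hyd' : ∀ᵐ t, s ≤ t → HasDerivAt y (-(b t) * x (h t)) t := by
    filter_upwards [hyd] with t ht hst
    exact (ht hst).congr_deriv (by ring)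
  set T := max s D
  have hsT : s ≤ T := le_max_left _ _
  have hTD : T ≤ s + D := max_le (by linarith) (by linarith)
  obtain ⟨hxT, hyT⟩ := H₁ s T K x y hs hsT hTD hxK (hx.locally_essBounded T) (hyac T hsT) hys hyx
    hyd'
  have hdec := H₂ T (C₁ * K) x y (le_max_right _ _) hxT hyT hx.locally_essBounded
    (fun R hR => (hyac R (hsT.trans hR)).mono (by
      rw [uIcc_of_le hR, uIcc_of_le (hsT.trans hR)]; exact Icc_subset_Icc hsT le_rfl))
    (by filter_upwards [hyx] with t ht hTt; exact ht (hsT.trans hTt))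
    (by filter_upwards [hyd'] with t ht hTt; exact ht (hsT.trans hTt))
  filter_upwards [hxT, hdec] with t ht1 ht2 hst
  have hCK : 0 ≤ C₁ * K := by positivity
  rcases le_total t T with htT | htT
  · have h1 : 1 ≤ Real.exp (γ * D) * Real.exp (-γ * (t - s)) := by
      rw [← Real.exp_add]
      exact Real.one_le_exp (by nlinarith)
    calc |x t| ≤ C₁ * K := ht1 htT
      _ ≤ (C₂ + 1) * (C₁ * K) := le_mul_of_one_le_left hCK (by linarith)
      _ ≤ (C₂ + 1) * (C₁ * K) * (Real.exp (γ * D) * Real.exp (-γ * (t - s))) :=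
          le_mul_of_one_le_right (by positivity) h1
      _ = _ := by ring
  · have h1 : Real.exp (-γ * (t - T)) ≤ Real.exp (γ * D) * Real.exp (-γ * (t - s)) := by
      rw [← Real.exp_add]
      exact Real.exp_le_exp.2 (by nlinarith)
    calc |x t| ≤ C₂ * (C₁ * K) * Real.exp (-γ * (t - T)) := ht2 htT
      _ ≤ (C₂ + 1) * (C₁ * K) * (Real.exp (γ * D) * Real.exp (-γ * (t - s))) := by
          gcongr
          linarith
      _ = _ := by ring
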